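/- Let $\mathbb U=\{z\in\mathbb C:|z|<1\}$ and $\mathbb U^*=\mathbb U\setminus\{0\}$. Let $p\ge 1$ and $m\ge 0$ be integers, and let $0\le\mu\le\lambda$ and $0\le\alpha<1$ be real numbers. Denote by $\Sigma_p$ the class of functions $$f(z)=z^{-p}+\sum_{k=1-p}^{\infty}a_kz^k$$ that are analytic and $p$-valent in $\mathbb U^*$ (every value is taken at most $p$ times and some value exactly $p$ times, counted with multiplicity). For $f\in\Sigma_p$ put $D^0_{\lambda\mu p}f=f$, $$D_{\lambda\mu p}f(z)=\lambda\mu\frac{[z^{p+1}f(z)]''}{z^{p-1}}+(\lambda-\mu)\frac{[z^{p+1}f(z)]'}{z^{p}}+(1-\lambda+\mu)f(z),$$ and $D^{m}_{\lambda\mu p}f=D_{\lambda\mu p}(D^{m-1}_{\lambda\mu p}f)$ for $m\ge1$. For $0<\beta\le1$, let $\Sigma_{\lambda\mu mp}(\alpha,\beta)$ be the class of all $f\in\Sigma_p$ such that, for every $z\in\mathbb U^*$, $D^m_{\lambda\mu p}f(z)\ne0$ and $$\left|\frac1p\,\frac{z(D^m_{\lambda\mu p}f(z))'}{D^m_{\lambda\mu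 p}f(z)}+1\right|<\beta\left|\frac1p\,\frac{z(D^m_{\lambda\mu p}f(z))'}{D^m_{\lambda\mu p}f(z)}+2\alpha-1\right|.$$ For $F,G$ analytic in $\mathbb U$ write $F\prec G$ if there is an analytic function $w$ in $\mathbb U$ with $w(0)=0$, $|w(z)|<1$ and $F(z)=G(w(z))$ for all $z\in\mathbb U$. **Theorem.** If $f\in\Sigma_{\lambda\mu mp}(\alpha,1)$, then $$z^pD^m_{\lambda\mu p}f(z)\prec(1-z)^{2p(1-\alpha)}\qquad(z\in\mathbb U),$$ where the left-hand side is extended to an analytic function in $\mathbb U$ by the value $1$ at $z=0$, and the power is the principal branch. -/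

import Mathlib

noncomputable section

namespace MeroMultivalent

/-- The open unit disk of the complex plane. -/
def unitDisk : Set ℂ := Metric.ball (0 : ℂ) 1

/-- The punctured open unit disk. -/
def puncturedDisk : Set ℂ := unitDisk \ {0}

/-- Schwarz functions: analytic in the unit disk, fixing the origin, with modulus less than one. -/
def IsSchwarz (w : ℂ → ℂ) : Prop :=
  AnalyticOnNhd ℂ w unitDisk ∧ w 0 = 0 ∧ ∀ z ∈ unitDisk, ‖w z‖ < 1

/-- Subordination of `f` to `g`, both analytic in the unit disk:
`f = g ∘ w` in the disk for some Schwarz function `w`. -/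
def Subordinate (f g : ℂ → ℂ) : Prop :=
  AnalyticOnNhd ℂ f unitDisk ∧ AnalyticOnNhd ℂ g unitDisk ∧
    ∃ w : ℂ → ℂ, IsSchwarz w ∧ ∀ z ∈ unitDisk, f z = g (w z)

/-- `f` is `p`-valent in `S`: it takes every value at most `p` times, counted with multiplicity,
and some value exactly `p` times.  Multiplicities are orders of vanishing of `f - c`. -/
def IsPValentOn (p : ℕ) (f : ℂ → ℂ) (S : Set ℂ) : Prop :=
  (∀ c : ℂ, ∀ s : Finset ℂ, (s : Set ℂ) ⊆ S →
      ∑ z ∈ s, analyticOrderAt (fun ζ => f ζ - c) z ≤ (p : ℕ∞)) ∧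
    ∃ c : ℂ, ∃ s : Finset ℂ, (s : Set ℂ) ⊆ S ∧
      ∑ z ∈ s, analyticOrderAt (fun ζ => f ζ - c) z = (p : ℕ∞)

/-- The class of functions `f(z) = z^{-p} + ∑_{k ≥ 1-p} a_k z^k`, analytic and `p`-valent in the
punctured unit disk.  The summation index is `k = n + 1 - p` with `n = 0, 1, 2, …`.
Only the values of `f` in the punctured disk matter. -/
def SigmaP (p : ℕ) (f : ℂ → ℂ) : Prop :=
  AnalyticOnNhd ℂ f puncturedDisk ∧
    (∃ a : ℤ → ℂ, ∀ z ∈ puncturedDisk,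
      HasSum (fun n : ℕ => a ((n : ℤ) + 1 - p) * z ^ ((n : ℤ) + 1 - p))
        (f z - z ^ (-(p : ℤ)))) ∧
    IsPValentOn p f puncturedDisk

/-- One application of the differential operator,
`l μ [z^{p+1} f]'' / z^{p-1} + (l - μ) [z^{p+1} f]' / z^p + (1 - l + μ) f`. -/
def diffOp (l μ : ℝ) (p : ℕ) (f : ℂ → ℂ) : ℂ → ℂ := fun z =>
  (l : ℂ) * μ * (deriv (deriv fun ζ => ζ ^ (p + 1) * f ζ) z / z ^ ((p : ℤ) - 1)) +
    ((l : ℂ) - μ) * (deriv (fun ζ => ζ ^ (p + 1) * f ζ) z / z ^ p) +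
    (1 - (l : ℂ) + μ) * f z

/-- The iterated differential operator; for `m = 0` it is the identity. -/
def diffOpIter (l μ : ℝ) (p : ℕ) : ℕ → (ℂ → ℂ) → ℂ → ℂ
  | 0, f => f
  | m + 1, f => diffOp l μ p (diffOpIter l μ p m f)

/-- The class `Σ_{lμmp}(α, β)`.  With `F` the `m`-th iterate of the operator applied to `f`, it
asks that the quotient `z F'(z) / F(z)` be defined and satisfy the inequality at every point of
the punctured disk. -/
def SigmaClass (l μ : ℝ) (m p : ℕ) (α β : ℝ) (f : ℂ → ℂ) : Prop :=
  SigmaP p f ∧ ∀ z ∈ puncturedDisk,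
    diffOpIter l μ p m f z ≠ 0 ∧
    ‖1 / (p : ℂ) * (z * deriv (diffOpIter l μ p m f) z / diffOpIter l μ p m f z) + 1‖ <
      β * ‖1 / (p : ℂ) * (z * deriv (diffOpIter l μ p m f) z / diffOpIter l μ p m f z)
        + 2 * (α : ℂ) - 1‖

end MeroMultivalent

end

/-!
Write `z ^ p D^m f(z) = g(z)`. The operator multiplies each power `z ^ k` by a constant, which is `1`
for `k = -p`; hence `g` extends to an analytic function on the disk with `g(0) = 1`
(`SigmaP.exists_isNormalizedExtension`, `IsNormalizedExtension.diffOpIter`), without zeros because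
`D^m f` has none. With `q = z g' / (p g) = (1/p) z (D^m f)' / D^m f + 1` the defining inequality
reads `|q| < |q - 2 (1 - α)|`, that is, `Re q < 1 - α`.

Put `c = 2 p (1 - α)`, write `g = e^{-cG}` with `G(0) = 0`, and let `w = 1 - e^{-G}`. Then
`g = (1 - w) ^ c` and `z w' / (1 - w) = z G' = -q / (2 (1 - α))` has real part greater than `-1/2`.
It remains to see that `|w| < 1` (`norm_lt_one_of_neg_half_lt_re`). Otherwise, at a point of least
modulus with `|w| = 1`, Jack's lemma (`exists_one_le_mul_deriv_eq`) gives `z w' = k w` with `k ≥ 1`,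
and `Re (w / (1 - w)) = -1/2` on the unit circle, so `z w' / (1 - w)` has real part
`-k/2 ≤ -1/2`, a contradiction.
-/

open Metric Set Filter Topology ComplexConjugate

namespace MeroMultivalent

/-! ### Jack's lemma -/

theorem hasDerivAt_nonpos_of_le_right {φ : ℝ → ℝ} {φ' : ℝ} (h : HasDerivAt φ φ' 0)
    (hle : ∀ t : ℝ, 0 ≤ t → φ t ≤ φ 0) : φ' ≤ 0 := by
  refine le_of_tendsto h.tendsto_slope_zero_right ?_
  filter_upwards [self_mem_nhdsWithin] with t ht
  have ht : 0 < t := ht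
  have := hle t ht.le
  rw [zero_add, smul_eq_mul]
  exact mul_nonpos_of_nonneg_of_nonpos (inv_nonneg.2 ht.le) (by linarith)

theorem re_mul_conj_nonpos_of_norm_le_along_ray {χ : ℂ → ℂ} {χ' d : ℂ} (h : HasDerivAt χ χ' 0)
    (hle : ∀ t : ℝ, 0 ≤ t → ‖χ (t * d)‖ ≤ ‖χ 0‖) : (χ' * d * conj (χ 0)).re ≤ 0 := by
  have hray : HasDerivAt (fun t : ℝ => χ (t * d)) (χ' * d) 0 := by
    have h1 : HasDerivAt (fun t : ℝ => (t : ℂ) * d) d 0 := by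
      simpa using (Complex.ofRealCLM.hasDerivAt (x := (0 : ℝ))).mul_const d
    exact HasDerivAt.comp (0 : ℝ) (by simpa using h) h1
  have hn := hray.norm_sq
  have := hasDerivAt_nonpos_of_le_right hn (fun t ht => by
    simpa using pow_le_pow_left₀ (norm_nonneg _) (hle t ht) 2)
  simp only [Complex.ofReal_zero, zero_mul, Complex.inner] at this
  linarith

/-- **Jack's lemma**, normalized so that the extremal modulus is `1`. The function
`ζ ↦ w (z₀ e^ζ) e^{-ζ}` has modulus at most `1` on `Re ζ ≤ 0` by the Schwarz lemma, and modulus `1`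
at `0`; its derivatives there in the directions `±i` and `-1` give the two assertions. -/
theorem exists_one_le_mul_deriv_eq {w : ℂ → ℂ} {z₀ : ℂ} {r : ℝ}
    (hw : DifferentiableOn ℂ w (ball 0 r))
    (hr : ‖z₀‖ < r) (hz₀ : z₀ ≠ 0) (h0 : w 0 = 0) (hlt : ∀ z, ‖z‖ < ‖z₀‖ → ‖w z‖ ≤ 1)
    (h1 : ‖w z₀‖ = 1) : ∃ k : ℝ, 1 ≤ k ∧ z₀ * deriv w z₀ = k * w z₀ := by
  have hR : 0 < ‖z₀‖ := norm_pos_iff.2 hz₀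
  have hschwarz : ∀ z ∈ closedBall (0 : ℂ) ‖z₀‖, ‖w z‖ ≤ ‖z‖ / ‖z₀‖ := by
    have hball : ∀ z ∈ ball (0 : ℂ) ‖z₀‖, ‖w z‖ ≤ ‖z‖ / ‖z₀‖ := fun z hz => by
      have := Complex.dist_le_div_mul_dist_of_mapsTo_ball (R₂ := 1)
        (hw.mono (ball_subset_ball hr.le))
        (fun x hx => by simpa [h0] using hlt x (by simpa using hx)) hz
      simpa [h0, div_eq_inv_mul] using this
    have hcl : closure (ball (0 : ℂ) ‖z₀‖) = closedBall 0 ‖z₀‖ := closure_ball _ hR.ne'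
    rw [← hcl]
    intro z hz
    have hc : ContinuousOn w (closure (ball (0 : ℂ) ‖z₀‖)) := by
      rw [hcl]; exact hw.continuousOn.mono (closedBall_subset_ball hr)
    exact le_on_closure hball hc.norm (by fun_prop) hz
  set χ : ℂ → ℂ := fun ζ => w (z₀ * Complex.exp ζ) * Complex.exp (-ζ) with hχ
  have hχ0 : χ 0 = w z₀ := by simp [hχ]
  have hd : HasDerivAt χ (z₀ * deriv w z₀ - w z₀) 0 := by
    have hw' : HasDerivAt w (deriv w z₀) (z₀ * Complex.exp 0) := by
      simpa using (hw.differentiableAt (isOpen_ball.mem_nhds (by simpa using hr))).hasDerivAt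
    have he : HasDerivAt (fun ζ => z₀ * Complex.exp ζ) z₀ 0 := by
      simpa using (Complex.hasDerivAt_exp 0).const_mul z₀
    have hn : HasDerivAt (fun ζ : ℂ => Complex.exp (-ζ)) (-1) 0 := by
      simpa using (hasDerivAt_neg (0 : ℂ)).cexp
    refine ((hw'.comp (0 : ℂ) he).mul hn).congr_deriv ?_
    simp; ring
  have hχle : ∀ ζ : ℂ, ζ.re ≤ 0 → ‖χ ζ‖ ≤ ‖χ 0‖ := fun ζ hζ => by
    have hexp : ‖Complex.exp ζ‖ ≤ 1 := by rw [Complex.norm_exp]; exact Real.exp_le_one_iff.2 hζ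
    have := hschwarz (z₀ * Complex.exp ζ) (by
      simpa using mul_le_of_le_one_right hR.le hexp)
    rw [norm_mul, mul_div_cancel_left₀ _ hR.ne'] at this
    rw [hχ0, h1, hχ, norm_mul]
    calc _ ≤ ‖Complex.exp ζ‖ * ‖Complex.exp (-ζ)‖ := by gcongr
      _ = 1 := by rw [← norm_mul, ← Complex.exp_add]; simp
  have key : ∀ d : ℂ, d.re ≤ 0 → ((z₀ * deriv w z₀ - w z₀) * d * conj (w z₀)).re ≤ 0 :=
    fun d hd' => by
      rw [← hχ0]
      refine re_mul_conj_nonpos_of_norm_le_along_ray (hχ0 ▸ hd) fun t ht => hχle _ ?_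
      simpa using mul_nonpos_of_nonneg_of_nonpos ht hd'
  have hconj : w z₀ * conj (w z₀) = 1 := by
    rw [Complex.mul_conj, Complex.normSq_eq_norm_sq, h1]; simp
  set A : ℂ := z₀ * deriv w z₀ * conj (w z₀) with hA
  have hAd : ∀ d : ℂ, (z₀ * deriv w z₀ - w z₀) * d * conj (w z₀) = (A - 1) * d := fun d => by
    rw [hA]; linear_combination (-d) * hconj
  have k1 := key Complex.I (by simp)
  have k2 := key (-Complex.I) (by simp)
  have k3 := key (-1) (by simp)
  rw [hAd] at k1 k2 k3
  simp at k1 k2 k3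
  refine ⟨A.re, by linarith, ?_⟩
  have hAre : ((A.re : ℝ) : ℂ) = A := Complex.ext (by simp) (by simp; linarith)
  rw [hAre, hA]
  linear_combination (-(z₀ * deriv w z₀)) * hconj

theorem re_div_one_sub_of_norm_eq_one {w : ℂ} (h : ‖w‖ = 1) (hne : w ≠ 1) :
    (w / (1 - w)).re = -1 / 2 := by
  have h2 : w.re * w.re + w.im * w.im = 1 := by
    have := Complex.normSq_eq_norm_sq w
    rw [h, Complex.normSq_apply] at this
    linarith
  have hre : 1 - w.re ≠ 0 := fun hre => hne <| by
    have h3 : w.re = 1 := by linarith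
    rw [h3] at h2
    exact Complex.ext (by simpa using h3) (by simpa using h2)
  have hns : Complex.normSq (1 - w) = 2 * (1 - w.re) := by
    rw [Complex.normSq_apply]; simp; linear_combination h2
  rw [Complex.div_re, hns]
  simp
  field_simp
  linear_combination (-1 : ℝ) * h2

/-- If `|w|` reached `1` inside the disk, then at a point of least modulus where it does, Jack's
lemma would make `z w' / (1 - w)` a multiple `k ≥ 1` of `w / (1 - w)`, whose real part is `-1/2`. -/
theorem norm_lt_one_of_neg_half_lt_re {w : ℂ → ℂ} (hw : DifferentiableOn ℂ w unitDisk)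
    (h0 : w 0 = 0) (hne : ∀ z ∈ unitDisk, w z ≠ 1)
    (hre : ∀ z ∈ unitDisk, -1 / 2 < (z * deriv w z / (1 - w z)).re) :
    ∀ z ∈ unitDisk, ‖w z‖ < 1 := by
  by_contra! hcon
  obtain ⟨z₁, hz₁, hz₁w⟩ := hcon
  have hz₁' : ‖z₁‖ < 1 := by simpa [unitDisk] using hz₁
  have hsub : closedBall (0 : ℂ) ‖z₁‖ ⊆ unitDisk := closedBall_subset_ball hz₁'
  set K := closedBall (0 : ℂ) ‖z₁‖ ∩ (fun z => ‖w z‖) ⁻¹' Ici 1 with hK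
  have hKc : IsCompact K := (isCompact_closedBall (0 : ℂ) ‖z₁‖).of_isClosed_subset
    ((hw.continuousOn.mono hsub).norm.preimage_isClosed_of_isClosed isClosed_closedBall isClosed_Ici)
    inter_subset_left
  obtain ⟨z₀, ⟨hz₀b, hz₀w⟩, hmin⟩ := hKc.exists_isMinOn (f := fun z : ℂ => ‖z‖)
    ⟨z₁, by simp [hK, hz₁w]⟩ (by fun_prop)
  have hz₀w : 1 ≤ ‖w z₀‖ := hz₀w
  have hz₀n : ‖z₀‖ ≤ ‖z₁‖ := by simpa using hz₀b
  have hz₀ : z₀ ≠ 0 := by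
    rintro rfl
    rw [h0, norm_zero] at hz₀w
    linarith
  have hlt : ∀ z, ‖z‖ < ‖z₀‖ → ‖w z‖ < 1 := fun z hz => by
    by_contra! h
    have : ‖z₀‖ ≤ ‖z‖ := hmin (⟨by simpa using hz.le.trans hz₀n, h⟩ : z ∈ K)
    linarith
  have hz₀D : z₀ ∈ unitDisk := hsub hz₀b
  have h1 : ‖w z₀‖ = 1 := by
    refine le_antisymm ?_ hz₀w
    have hcl : closure (ball (0 : ℂ) ‖z₀‖) = closedBall 0 ‖z₀‖ :=
      closure_ball _ (norm_ne_zero_iff.2 hz₀)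
    refine le_on_closure (f := fun z => ‖w z‖) (g := fun _ => (1 : ℝ)) (s := ball 0 ‖z₀‖)
      (fun z hz => (hlt z (by simpa using hz)).le) ?_ continuousOn_const (x := z₀) (by simp [hcl])
    rw [hcl]
    exact (hw.continuousOn.mono ((closedBall_subset_closedBall hz₀n).trans hsub)).norm
  obtain ⟨k, hk, hkw⟩ := exists_one_le_mul_deriv_eq hw (hz₀n.trans_lt hz₁') hz₀ h0
    (fun z hz => (hlt z hz).le) h1
  have := hre z₀ hz₀D
  rw [hkw, mul_div_assoc, Complex.re_ofReal_mul,
    re_div_one_sub_of_norm_eq_one h1 (hne z₀ hz₀D)] at this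
  linarith

/-! ### Subordination to a power of `1 - z` -/

theorem isOpen_unitDisk : IsOpen unitDisk := isOpen_ball

theorem zero_mem_unitDisk : (0 : ℂ) ∈ unitDisk := by simp [unitDisk]

theorem isPreconnected_unitDisk : IsPreconnected unitDisk :=
  (convex_ball (0 : ℂ) 1).isPreconnected

theorem one_sub_mem_slitPlane {z : ℂ} (hz : ‖z‖ < 1) : 1 - z ∈ Complex.slitPlane := by
  refine Complex.mem_slitPlane_iff.2 (Or.inl ?_)
  have := Complex.re_le_norm z
  simp; linarith

theorem analyticOnNhd_one_sub_cpow (c : ℂ) : AnalyticOnNhd ℂ (fun z => (1 - z) ^ c) unitDisk :=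
  fun z hz => (analyticAt_const.sub analyticAt_id).cpow analyticAt_const
    (one_sub_mem_slitPlane (by simpa [unitDisk] using hz))

/-- An analytic function without zeros on the disk, with value `1` at the origin, has the form
`e^{-cG}`; the primitive `G` is used rather than a logarithm because `g` may leave every slit
plane. -/
theorem exists_eq_exp_neg_mul {g : ℂ → ℂ} {c : ℂ} (hc : c ≠ 0) (hg : DifferentiableOn ℂ g unitDisk)
    (hg0 : g 0 = 1) (hne : ∀ z ∈ unitDisk, g z ≠ 0) :
    ∃ G : ℂ → ℂ, G 0 = 0 ∧ (∀ z ∈ unitDisk, HasDerivAt G (-(deriv g z / g z) / c) z) ∧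
      ∀ z ∈ unitDisk, g z = Complex.exp (-(c * G z)) := by
  have hdiff : DifferentiableOn ℂ (fun z => -(deriv g z / g z) / c) unitDisk :=
    (((hg.deriv isOpen_unitDisk).div hg hne).neg).div_const c
  obtain ⟨G, hG0, hG⟩ := Complex.IsExactOn.with_val_at
    (DifferentiableOn.isExactOn_ball (c := 0) (r := 1) hdiff) 0 0
  refine ⟨G, hG0, hG, fun z hz => ?_⟩
  have hd : ∀ z ∈ unitDisk, HasDerivAt (fun z => g z * Complex.exp (c * G z)) 0 z := fun z hz => by
    have h1 := (hg.differentiableAt (isOpen_unitDisk.mem_nhds hz)).hasDerivAt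
    refine (h1.mul ((hG z hz).const_mul c).cexp).congr_deriv ?_
    field_simp [hne z hz]
    ring
  have := isOpen_unitDisk.is_const_of_deriv_eq_zero isPreconnected_unitDisk
    (fun z hz => (hd z hz).differentiableAt.differentiableWithinAt)
    (fun z hz => (hd z hz).deriv) hz zero_mem_unitDisk
  simp only [hg0, hG0, mul_zero, Complex.exp_zero, mul_one] at this
  rw [Complex.exp_neg]
  exact eq_inv_of_mul_eq_one_left this

/-- For `g = (1 - z) ^ c` the function `z g' / g = -c z / (1 - z)` maps the disk onto the half plane
`Re < c / 2`, so the hypothesis says that `z g' / g` is subordinate to it. The Schwarz function is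
`w = 1 - e^{-G}`, where `g = e^{-cG}`, since then `z G' = z w' / (1 - w)`. -/
theorem subordinate_one_sub_cpow {g : ℂ → ℂ} {c : ℝ} (hc : 0 < c) (hg : AnalyticOnNhd ℂ g unitDisk)
    (hg0 : g 0 = 1) (hne : ∀ z ∈ unitDisk, g z ≠ 0)
    (hre : ∀ z ∈ unitDisk, (z * deriv g z / g z).re < c / 2) :
    Subordinate g (fun z => (1 - z) ^ (c : ℂ)) := by
  have hc' : (c : ℂ) ≠ 0 := Complex.ofReal_ne_zero.2 hc.ne'
  obtain ⟨G, hG0, hG, hgG⟩ := exists_eq_exp_neg_mul hc' hg.differentiableOn hg0 hne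
  set w : ℂ → ℂ := fun z => 1 - Complex.exp (-G z) with hw
  have hwd : ∀ z ∈ unitDisk,
      HasDerivAt w (Complex.exp (-G z) * (-(deriv g z / g z) / c)) z := fun z hz => by
    refine ((hG z hz).neg.cexp.const_sub 1).congr_deriv ?_
    simp only [Pi.neg_apply]
    ring
  have hwdiff : DifferentiableOn ℂ w unitDisk :=
    fun z hz => (hwd z hz).differentiableAt.differentiableWithinAt
  have hw0 : w 0 = 0 := by simp [hw, hG0]
  have hw1 : ∀ z, 1 - w z = Complex.exp (-G z) := fun z => by simp [hw]
  have hlt : ∀ z ∈ unitDisk, ‖w z‖ < 1 := by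
    refine norm_lt_one_of_neg_half_lt_re hwdiff hw0 (fun z _ h => ?_) fun z hz => ?_
    · exact Complex.exp_ne_zero (-G z) (by rw [← hw1, h, sub_self])
    · have heq : z * deriv w z / (1 - w z) = ((-1 / c : ℝ) : ℂ) * (z * deriv g z / g z) := by
        have := hne z hz
        rw [(hwd z hz).deriv, hw1]
        push_cast
        field_simp [Complex.exp_ne_zero]
      rw [heq, Complex.re_ofReal_mul]
      have := hre z hz
      rw [neg_div, neg_div, neg_mul, one_div_mul_eq_div, neg_lt_neg_iff, div_lt_div_iff₀ hc two_pos]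
      linarith
  -- `log (e^{-G}) = -G` is not automatic: both sides are primitives of the same function.
  have hlog : ∀ z ∈ unitDisk, Complex.log (1 - w z) = -G z := by
    have hl : ∀ z ∈ unitDisk, HasDerivAt (fun z => Complex.log (1 - w z))
        (-(-(deriv g z / g z) / c)) z := fun z hz => by
      refine (((hwd z hz).const_sub 1).clog (one_sub_mem_slitPlane (hlt z hz))).congr_deriv ?_
      rw [hw1]
      field_simp [Complex.exp_ne_zero]
    exact isOpen_unitDisk.eqOn_of_deriv_eq isPreconnected_unitDisk
      (fun z hz => (hl z hz).differentiableAt.differentiableWithinAt)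
      (fun z hz => (hG z hz).neg.differentiableAt.differentiableWithinAt)
      (fun z hz => by rw [(hl z hz).deriv]; exact ((hG z hz).neg.deriv).symm)
      zero_mem_unitDisk (by simp [hw0, hG0])
  refine ⟨hg, analyticOnNhd_one_sub_cpow c, w,
    ⟨hwdiff.analyticOnNhd isOpen_unitDisk, hw0, hlt⟩, fun z hz => ?_⟩
  have h1w : 1 - w z ≠ 0 := by rw [hw1]; exact Complex.exp_ne_zero _
  change _ = (1 - w z) ^ (c : ℂ)
  rw [Complex.cpow_def_of_ne_zero h1w, hlog z hz, hgG z hz]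
  congr 1; ring

/-! ### Functions with leading term `z ^ (-p)` -/

/-- `g` completes `z ^ p f(z)` to an analytic function on the whole disk, with value `1` at `0`. -/
def IsNormalizedExtension (p : ℕ) (f g : ℂ → ℂ) : Prop :=
  AnalyticOnNhd ℂ g unitDisk ∧ g 0 = 1 ∧ ∀ z ∈ puncturedDisk, z ^ p * f z = g z

theorem isOpen_puncturedDisk : IsOpen puncturedDisk := isOpen_unitDisk.sdiff isClosed_singleton

/-- A power series converging at every nonzero point of the unit disk is analytic on the disk. -/
theorem exists_analyticOnNhd_hasSum {b : ℕ → ℂ}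
    (hb : ∀ z ∈ puncturedDisk, Summable fun n => b n * z ^ n) :
    ∃ h : ℂ → ℂ, AnalyticOnNhd ℂ h unitDisk ∧
      ∀ z ∈ unitDisk, HasSum (fun n => b n * z ^ n) (h z) := by
  set q := FormalMultilinearSeries.ofScalars ℂ b with hq
  have hrad : 1 ≤ q.radius := by
    refine ENNReal.le_of_forall_nnreal_lt fun r hr => ?_
    rcases eq_or_ne r 0 with rfl | hr0
    · simp
    have hr1 : (r : ℝ) < 1 := by exact_mod_cast hr
    have hs := hb (r : ℝ) ⟨by simpa [unitDisk] using hr1, by simpa using hr0⟩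
    refine q.le_radius_of_tendsto (l := 0) ?_
    simpa [hq, FormalMultilinearSeries.ofScalars_norm] using hs.tendsto_atTop_zero.norm
  have hball := (q.hasFPowerSeriesOnBall (zero_lt_one.trans_le hrad)).mono zero_lt_one hrad
  have hmem : ∀ z ∈ unitDisk, z ∈ Metric.eball (0 : ℂ) 1 := fun z hz => by
    rw [← ENNReal.ofReal_one, Metric.eball_ofReal]
    exact hz
  refine ⟨q.sum, fun z hz => hball.analyticAt_of_mem (hmem z hz), fun z hz => ?_⟩
  simpa [hq, FormalMultilinearSeries.ofScalars_apply_eq, smul_eq_mul, mul_comm] using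
    hball.hasSum (hmem z hz)

theorem SigmaP.exists_isNormalizedExtension {p : ℕ} {f : ℂ → ℂ} (hf : SigmaP p f) :
    ∃ g, IsNormalizedExtension p f g := by
  obtain ⟨-, ⟨a, ha⟩, -⟩ := hf
  have hmul : ∀ z ∈ puncturedDisk, HasSum (fun n : ℕ => z * (a ((n : ℤ) + 1 - p) * z ^ n))
      (z ^ p * f z - 1) := fun z hz => by
    have hz0 : z ≠ 0 := hz.2
    have h := (ha z hz).mul_left (z ^ p)
    rw [mul_sub, zpow_neg, zpow_natCast, mul_inv_cancel₀ (pow_ne_zero p hz0)] at h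
    refine h.congr_fun fun n => ?_
    rw [zpow_sub₀ hz0, zpow_add₀ hz0]
    simp only [zpow_natCast, zpow_one]
    field_simp
  obtain ⟨h, hh, hsum⟩ := exists_analyticOnNhd_hasSum (b := fun n : ℕ => a ((n : ℤ) + 1 - p))
    fun z hz => (summable_mul_left_iff (a := z) hz.2).1 (hmul z hz).summable
  refine ⟨fun z => 1 + z * h z, fun z hz => ?_, by simp, fun z hz => ?_⟩
  · exact analyticAt_const.add (analyticAt_id.mul (hh z hz))
  · have := (hmul z hz).unique ((hsum z hz.1).mul_left z)
    change _ = 1 + z * h z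
    rw [← this]; ring

/-- In terms of the completed function the operator reads
`g ↦ g + (l - μ) z g' + l μ (2 z g' + z ^ 2 g'')`, which fixes the value at `0`. -/
theorem IsNormalizedExtension.diffOp {l μ : ℝ} {p : ℕ} {f g : ℂ → ℂ}
    (h : IsNormalizedExtension p f g) : ∃ g', IsNormalizedExtension p (diffOp l μ p f) g' := by
  obtain ⟨hg, hg0, hfg⟩ := h
  refine ⟨fun z => g z + (l - μ) * (z * deriv g z) +
    l * μ * (2 * (z * deriv g z) + z ^ 2 * deriv (deriv g) z), fun z hz => ?_, by simp [hg0],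
    fun z hz => ?_⟩
  · have h0 := hg z hz
    have h1 := h0.deriv
    have h2 := h1.deriv
    fun_prop
  · have hz0 : z ≠ 0 := hz.2
    have hd : ∀ x ∈ unitDisk, HasDerivAt g (deriv g x) x := fun x hx =>
      (hg x hx).differentiableAt.hasDerivAt
    have heq : ∀ x ∈ puncturedDisk,
        (fun ζ => ζ ^ (p + 1) * f ζ) =ᶠ[𝓝 x] fun ζ => ζ * g ζ := fun x hx => by
      filter_upwards [isOpen_puncturedDisk.mem_nhds hx] with ζ hζ
      rw [← hfg ζ hζ]; ring
    have hd1 : ∀ x ∈ puncturedDisk,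
        deriv (fun ζ => ζ ^ (p + 1) * f ζ) x = g x + x * deriv g x := fun x hx => by
      rw [(heq x hx).deriv_eq]
      exact ((hasDerivAt_id x).mul (hd x hx.1)).deriv.trans (by simp)
    have hd2 : deriv (deriv fun ζ => ζ ^ (p + 1) * f ζ) z
        = 2 * deriv g z + z * deriv (deriv g) z := by
      have he : deriv (fun ζ => ζ ^ (p + 1) * f ζ) =ᶠ[𝓝 z] fun x => g x + x * deriv g x := by
        filter_upwards [isOpen_puncturedDisk.mem_nhds hz] with x hx using hd1 x hx
      rw [he.deriv_eq]
      have hdd := (hg z hz.1).deriv.differentiableAt.hasDerivAt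
      refine ((hd z hz.1).add ((hasDerivAt_id z).mul hdd)).deriv.trans ?_
      simp; ring
    simp only [MeroMultivalent.diffOp]
    rw [hd2, hd1 z hz, ← hfg z hz, zpow_sub_one₀ hz0, zpow_natCast]
    field_simp
    ring

theorem IsNormalizedExtension.diffOpIter {l μ : ℝ} {p : ℕ} {f g : ℂ → ℂ}
    (h : IsNormalizedExtension p f g) (m : ℕ) :
    ∃ g', IsNormalizedExtension p (diffOpIter l μ p m f) g' := by
  induction m with
  | zero => exact ⟨g, h⟩
  | succ m ih =>
    obtain ⟨g', hg'⟩ := ih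
    exact hg'.diffOp

theorem IsNormalizedExtension.mul_deriv_div {p : ℕ} {f g : ℂ → ℂ}
    (h : IsNormalizedExtension p f g) {z : ℂ} (hz : z ∈ puncturedDisk) (hfz : f z ≠ 0) :
    z * deriv g z / g z = p + z * deriv f z / f z := by
  have hz0 : z ≠ 0 := hz.2
  have hzp : z ^ p ≠ 0 := pow_ne_zero p hz0
  have hpd : DifferentiableAt ℂ (fun ζ : ℂ => ζ ^ p) z := differentiableAt_pow p
  have hev : g =ᶠ[𝓝 z] fun ζ => ζ ^ p * f ζ := by
    filter_upwards [isOpen_puncturedDisk.mem_nhds hz] with ζ hζ using (h.2.2 ζ hζ).symm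
  have hf : DifferentiableAt ℂ f z := by
    have h1 : (fun ζ => g ζ / ζ ^ p) =ᶠ[𝓝 z] f := by
      filter_upwards [isOpen_puncturedDisk.mem_nhds hz] with ζ hζ
      have : ζ ≠ 0 := hζ.2
      rw [← h.2.2 ζ hζ]; field_simp
    exact ((h.1 z hz.1).differentiableAt.div hpd hzp).congr_of_eventuallyEq h1.symm
  have hld : logDeriv g z = p / z + logDeriv f z := by
    have hmul := logDeriv_mul (f := fun ζ : ℂ => ζ ^ p) (g := f) z hzp hfz hpd hf
    rw [logDeriv_pow] at hmul
    rw [logDeriv_apply, hev.deriv_eq, hev.eq_of_nhds, ← hmul, logDeriv_apply]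
  rw [mul_div_assoc, mul_div_assoc, ← logDeriv_apply, ← logDeriv_apply, hld]
  field_simp

theorem re_lt_of_norm_lt_norm_sub {q : ℂ} {t : ℝ} (ht : 0 < t) (h : ‖q‖ < ‖q - 2 * t‖) :
    q.re < t := by
  have h2 := mul_self_lt_mul_self (norm_nonneg _) h
  simp only [Complex.norm_mul_self_eq_normSq, Complex.normSq_apply] at h2
  simp at h2
  nlinarith

end MeroMultivalent

open MeroMultivalent in
/-- The function `z^p D^m f(z)` has a removable singularity at `0`, where its value is `1`; being
subordinate includes that the function so completed is analytic in the whole unit disk.  The power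
on the right is the principal branch. -/
theorem theorem2p3 (l μ : ℝ) (hμ : 0 ≤ μ) (hμl : μ ≤ l) (m p : ℕ) (hp : 1 ≤ p)
    (α : ℝ) (hα0 : 0 ≤ α) (hα1 : α < 1) (f : ℂ → ℂ)
    (hf : MeroMultivalent.SigmaClass l μ m p α 1 f) :
    MeroMultivalent.Subordinate
      (Function.update (fun z : ℂ => z ^ p * MeroMultivalent.diffOpIter l μ p m f z) 0 1)
      (fun z : ℂ => (1 - z) ^ ((2 * (p : ℝ) * (1 - α) : ℝ) : ℂ)) := by
  obtain ⟨hS, hineq⟩ := hf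
  obtain ⟨g₀, hg₀⟩ := hS.exists_isNormalizedExtension
  obtain ⟨g, hg⟩ := hg₀.diffOpIter (l := l) (μ := μ) m
  have hp' : (0 : ℝ) < p := by exact_mod_cast hp
  have hc : 0 < 2 * (p : ℝ) * (1 - α) := mul_pos (by positivity) (by linarith)
  have hne : ∀ z ∈ unitDisk, g z ≠ 0 := fun z hz => by
    rcases eq_or_ne z 0 with rfl | hz0
    · simp [hg.2.1]
    · rw [← hg.2.2 z ⟨hz, hz0⟩]
      exact mul_ne_zero (pow_ne_zero p hz0) (hineq z ⟨hz, hz0⟩).1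
  have hre : ∀ z ∈ unitDisk, (z * deriv g z / g z).re < 2 * (p : ℝ) * (1 - α) / 2 := fun z hz => by
    rcases eq_or_ne z 0 with rfl | hz0
    · simpa using hc
    obtain ⟨hF, hlt⟩ := hineq z ⟨hz, hz0⟩
    have hpc : (p : ℂ) ≠ 0 := by exact_mod_cast hp'.ne'
    have hq : 1 / (p : ℂ) * (z * deriv (diffOpIter l μ p m f) z / diffOpIter l μ p m f z)
        = 1 / (p : ℂ) * (z * deriv g z / g z) - 1 := by
      rw [hg.mul_deriv_div ⟨hz, hz0⟩ hF, mul_add, one_div_mul_cancel hpc]; ring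
    rw [hq, one_mul] at hlt
    have := re_lt_of_norm_lt_norm_sub (q := ((1 / p : ℝ) : ℂ) * (z * deriv g z / g z))
      (t := 1 - α) (by linarith) (by
        convert hlt using 2
        · push_cast; ring
        · push_cast; ring)
    rw [Complex.re_ofReal_mul, one_div_mul_eq_div, div_lt_iff₀ hp'] at this
    linarith
  obtain ⟨-, hpow, w, hw, hgw⟩ := subordinate_one_sub_cpow hc hg.1 hg.2.1 hne hre
  have heq : Set.EqOn g (Function.update (fun z => z ^ p * diffOpIter l μ p m f z) 0 1)
      unitDisk := fun z hz => by
    rcases eq_or_ne z 0 with rfl | hz0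
    · simp [hg.2.1]
    · simp [hz0, hg.2.2 z ⟨hz, hz0⟩]
  exact ⟨hg.1.congr isOpen_unitDisk heq, hpow, w, hw, fun z hz => (heq hz).symm.trans (hgw z hz)⟩
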